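/- For $d,m\ge 1$ let $h:[d]\to[m]$ and $s:[d]\to\{+1,-1\}$ be random hash functions whose values $h(1),\dots,h(d),s(1),\dots,s(d)$ are mutually independent and uniformly distributed. The count-sketch of $\mathbf p\in\mathbb R^d$ is $\mathrm{CS}(\mathbf p)_l=\sum_{j:\,h(j)=l}s(j)p_j$, $l\in[m]$, and its CS-SRP hash code is $\xi(\mathbf p)=(\mathrm{sgn}(\mathrm{CS}(\mathbf p)_1),\dots,\mathrm{sgn}(\mathrm{CS}(\mathbf p)_m))\in\{0,1\}^m$, where $\mathrm{sgn}(x)=1$ if $x>0$ and $\mathrm{sgn}(x)=0$ otherwise. Let $\theta_{(\mathbf u,\mathbf v)}=\cos^{-1}\left(\frac{\mathbf u^T\mathbf v}{\|\mathbf u\|\|\mathbf v\|}\right)$. Fix $\delta>0$, $K\in\mathbb R$, $\kappa>0$, and let $\mathcal R_d$ be the set of pairs $(\mathbf u,\mathbf v)\in\mathbb R^d\times\mathbb R^d$ with $$\frac1d\sum_{j=1}^d(u_j^2+v_j^2)^{\frac{2+\delta}2}\le K,\qquad \frac{\|\mathbf u\|^2}{d}\cdot\frac{\|\mathbf v\|^2}{d}-\left(\frac{\langle\mathbf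 u,\mathbf v\rangle}{d}\right)^2\ge\kappa .$$ Let $m=m(d)\ge1$ be integers with $m=o\left(d^{\frac{\delta}{2(2+\delta)}}\right)$ as $d\to\infty$ (for instance, $m$ constant). Then: 1. For all sequences $\mathbf u=\mathbf u^{(d)}$, $\mathbf v=\mathbf v^{(d)}$ with $(\mathbf u,\mathbf v)\in\mathcal R_d$ for all large $d$, as $d\to\infty$, $$\max_{l\in[m]}\left|\Pr[\xi(\mathbf u)_l=\xi(\mathbf v)_l]-\left(1-\frac{\theta_{(\mathbf u,\mathbf v)}}{\pi}\right)\right|\to0,$$ $$\Pr[\xi(\mathbf u)_1=\xi(\mathbf v)_1,\dots,\xi(\mathbf u)_m=\xi(\mathbf v)_m]-\left(1-\frac{\theta_{(\mathbf u,\mathbf v)}}{\pi}\right)^m\to0.$$ 2. CS-SRP is asymptotically a locality sensitive hash for cosine similarity: let $-1\le R_2<R_1\le1$ and $P_i=1-\cos^{-1}(R_i)/\pi$. Then $P_2<P_1$, $P_2^m<P_1^m$, and for every $\varepsilon>0$ there is $d_0$ such that for all $d\ge d_0$ and all $(\mathbf u,\mathbf v)\in\mathcal R_d$: if $\frac{\mathbf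 u^T\mathbf v}{\|\mathbf u\|\|\mathbf v\|}\ge R_1$ then $\Pr[\xi(\mathbf u)=\xi(\mathbf v)]\ge P_1^m-\varepsilon$, and if $\frac{\mathbf u^T\mathbf v}{\|\mathbf u\|\|\mathbf v\|}\le R_2$ then $\Pr[\xi(\mathbf u)=\xi(\mathbf v)]\le P_2^m+\varepsilon$. For every choice of indices $l=l(d)\in[m]$ the same holds for the single bit $\xi(\cdot)_l$, with $P_1,P_2$ in place of $P_1^m,P_2^m$. -/

import Mathlib

open MeasureTheory ProbabilityTheory Filter Topology Asymptotics

noncomputable section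

/-- Random hash functions `h : [d] → [m]` and `s : [d] → {+1, -1}` on a probability space: every
`h j` is uniform on `[m]`, every `s j` is a uniform sign, and all the values `h j`, `s j`
(`j ∈ [d]`) are mutually independent. -/
structure IsCountSketchHash {Ω : Type*} [MeasurableSpace Ω] (μ : Measure Ω) {d m : ℕ}
    (h : Fin d → Ω → Fin m) (s : Fin d → Ω → ℤˣ) : Prop where
  measurable_h : ∀ j, Measurable (h j)
  measurable_s : ∀ j, Measurable (s j)
  uniform_h : ∀ j l, μ.real {ω | h j ω = l} = 1 / (m : ℝ)
  uniform_s : ∀ j σ, μ.real {ω | s j ω = σ} = 1 / 2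
  indep_h_s : ∀ j, IndepFun (h j) (s j) μ
  iIndep : iIndepFun (fun j ω => (h j ω, s j ω)) μ

/-- The count-sketch `CS(p)_l = ∑_{h(j) = l} s(j) p_j` for given `h` and `s`. -/
def countSketch {d m : ℕ} (h : Fin d → Fin m) (s : Fin d → ℤˣ)
    (p : EuclideanSpace ℝ (Fin d)) (l : Fin m) : ℝ :=
  ∑ j with h j = l, ((s j : ℤ) : ℝ) * p j

/-- `sgn x = 1` if `x > 0`, and `sgn x = 0` otherwise. -/
def signBit (x : ℝ) : Fin 2 := if 0 < x then 1 else 0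

/-- The CS-SRP hash code `ξ(u) = (sgn CS(u)_1, …, sgn CS(u)_m)`. -/
def csSRP {d m : ℕ} (h : Fin d → Fin m) (s : Fin d → ℤˣ)
    (u : EuclideanSpace ℝ (Fin d)) : Fin m → Fin 2 :=
  fun l => signBit (countSketch h s u l)

/-- Cosine similarity `uᵀv / (‖u‖ ‖v‖)`. -/
def cosSim {d : ℕ} (u v : EuclideanSpace ℝ (Fin d)) : ℝ :=
  inner ℝ u v / (‖u‖ * ‖v‖)

/-- The angle `θ(u, v) = cos⁻¹ (uᵀv / (‖u‖ ‖v‖))`. -/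
def theta {d : ℕ} (u v : EuclideanSpace ℝ (Fin d)) : ℝ :=
  Real.arccos (cosSim u v)

/-- Pairs `(u, v)` in `ℝ^d` whose coordinate average of `(u_j² + v_j²)^((2+δ)/2)` is at most `K`
and for which the matrix of coordinate averages of `u_j²`, `u_j v_j`, `v_j²` (that is, `1/d` times
the Gram matrix) has determinant at least `κ`. -/
def regularPairs (δ K κ : ℝ) (d : ℕ) :
    Set (EuclideanSpace ℝ (Fin d) × EuclideanSpace ℝ (Fin d)) :=
  {w | (∑ j, (w.1 j ^ 2 + w.2 j ^ 2) ^ ((2 + δ) / 2)) / d ≤ K ∧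
    κ ≤ (‖w.1‖ ^ 2 / d) * (‖w.2‖ ^ 2 / d) - (inner ℝ w.1 w.2 / d) ^ 2}

/-- A sequence of random hash families `H d` on `X d` (with randomness `ω` of law `μ d`) is
asymptotically `(R₁, R₂, P₁, P₂)`-sensitive for the similarity measures `sim d`, on the given
classes of pairs: `R₂ < R₁`, `P₂ < P₁`, pairs of similarity at least `R₁` collide with
probability at least `P₁ - o(1)`, and pairs of similarity at most `R₂` collide with probability
at most `P₂ + o(1)`, with `o(1)` uniform over the pairs. -/
def IsAsymptoticallySensitive {Ω X U : ℕ → Type*} [∀ d, MeasurableSpace (Ω d)]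
    (μ : ∀ d, Measure (Ω d)) (H : ∀ d, Ω d → X d → U d) (sim : ∀ d, X d → X d → ℝ)
    (pairs : ∀ d, Set (X d × X d)) (R₁ R₂ : ℝ) (P₁ P₂ : ℕ → ℝ) : Prop :=
  R₂ < R₁ ∧ (∀ d, P₂ d < P₁ d) ∧
    ∀ ε > 0, ∀ᶠ d in atTop, ∀ p q, (p, q) ∈ pairs d →
      (R₁ ≤ sim d p q → P₁ d - ε ≤ (μ d).real {ω | H d ω p = H d ω q}) ∧
      (sim d p q ≤ R₂ → (μ d).real {ω | H d ω p = H d ω q} ≤ P₂ d + ε)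

end

/-! Fix `k` distinct bins. The `2k` sketch values of the normalised vectors `p`, `q`, scaled by
`√m`, form a sum over coordinates `j` of independent vectors, so their characteristic function is an
exact product (`IsCountSketchHash.charFun_map_scaledSketch`). The bins are dependent, but each
factor is `1 - y_j` plus a quartic error, and `1 - y_j` agrees with `exp (-y_j)` to second order.
Hence the product is close to the characteristic function of `k` independent Gaussian pairs with
correlation `cos θ` once `m (p_j² + q_j²)` is uniformly small (`abs_prod_cos_sub_exp_le`). For the
Gaussian pairs, Sheppard's formula gives agreement of all signs with probability `(1 - θ/π)^k`
(`planeGaussian_real_same_sign`). Lévy continuity and compactness of `[0, π]` make the comparison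
uniform in `θ` (`exists_pos_abs_real_sameSign_sub_le`).

On regular pairs the moment bound limits the largest coordinate and the determinant bounds the norms
from below, so `m (p_j² + q_j²)` is `O(m d^(-δ/(2+δ)))` and tends to `0`.

All of this is for fixed `k`, whereas `m` may grow. The determinant also keeps `θ` away from `0`, so
`1 - θ/π ≤ c < 1`. Choose `k` with `c^k` small: if `m < k`, only finitely many code lengths occur;
if `m ≥ k`, agreement on `k` bins is already unlikely, and both quantities being compared are small
(`eventually_abs_code_collision_sub_le`). Sensitivity then follows from monotonicity of `arccos`. -/

noncomputable section

/-! ### Gaussian measure of planar cones and Sheppard's formula -/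

/-- The standard Gaussian measure on the plane. -/
abbrev planeGaussian : Measure (ℝ × ℝ) := (gaussianReal 0 1).prod (gaussianReal 0 1)

lemma planeGaussian_apply {S : Set (ℝ × ℝ)} (hS : MeasurableSet S) :
    planeGaussian S = ∫⁻ p in polarCoord.target, ENNReal.ofReal p.1 *
      S.indicator (fun p => gaussianPDF 0 1 p.1 * gaussianPDF 0 1 p.2) (polarCoord.symm p) := by
  have h1 : planeGaussian = (volume : Measure (ℝ × ℝ)).withDensity
      (fun p => gaussianPDF 0 1 p.1 * gaussianPDF 0 1 p.2) := by
    rw [planeGaussian, gaussianReal_of_var_ne_zero 0 one_ne_zero,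
      prod_withDensity (by fun_prop) (by fun_prop)]
    rfl
  rw [h1, withDensity_apply _ hS, ← lintegral_indicator hS, ← lintegral_comp_polarCoord_symm]
  simp only [smul_eq_mul]

lemma gaussianPDF_mul_polarCoord_symm (p : ℝ × ℝ) :
    gaussianPDF 0 1 (polarCoord.symm p).1 * gaussianPDF 0 1 (polarCoord.symm p).2 =
      gaussianPDF 0 1 p.1 * gaussianPDF 0 1 0 := by
  simp only [gaussianPDF, gaussianPDFReal, polarCoord_symm_apply]
  rw [← ENNReal.ofReal_mul (by positivity), ← ENNReal.ofReal_mul (by positivity)]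
  congr 1
  rw [mul_mul_mul_comm, ← Real.exp_add, mul_mul_mul_comm, ← Real.exp_add]
  congr 2
  have := Real.sin_sq_add_cos_sq p.2
  simp only [sub_zero, NNReal.coe_one, mul_one]
  linear_combination (-p.1 ^ 2 / 2) * this

/-- The standard Gaussian measure of a cone is proportional to its angle. -/
lemma planeGaussian_cone {S : Set (ℝ × ℝ)} (hS : MeasurableSet S) {A : Set ℝ}
    (hA : MeasurableSet A)
    (hSA : ∀ r > 0, ∀ φ ∈ Set.Ioo (-Real.pi) Real.pi,
      (r * Real.cos φ, r * Real.sin φ) ∈ S ↔ φ ∈ A) :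
    planeGaussian S = (∫⁻ r in Set.Ioi 0, ENNReal.ofReal r * (gaussianPDF 0 1 r *
      gaussianPDF 0 1 0)) * volume (A ∩ Set.Ioo (-Real.pi) Real.pi) := by
  rw [planeGaussian_apply hS, polarCoord_target]
  have h1 : ∀ p ∈ (Set.Ioi (0 : ℝ) ×ˢ Set.Ioo (-Real.pi) Real.pi), ENNReal.ofReal p.1 *
      S.indicator (fun p => gaussianPDF 0 1 p.1 * gaussianPDF 0 1 p.2) (polarCoord.symm p) =
      (ENNReal.ofReal p.1 * (gaussianPDF 0 1 p.1 * gaussianPDF 0 1 0)) *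
        A.indicator (fun _ => 1) p.2 := by
    rintro p ⟨hr, hφ⟩
    by_cases h : p.2 ∈ A
    · have : polarCoord.symm p ∈ S := (hSA p.1 hr p.2 hφ).2 h
      rw [Set.indicator_of_mem this, Set.indicator_of_mem h, gaussianPDF_mul_polarCoord_symm,
        mul_one]
    · have : polarCoord.symm p ∉ S := fun h' => h ((hSA p.1 hr p.2 hφ).1 h')
      rw [Set.indicator_of_notMem this, Set.indicator_of_notMem h, mul_zero, mul_zero]
  rw [setLIntegral_congr_fun (measurableSet_Ioi.prod measurableSet_Ioo) h1,
    Measure.volume_eq_prod, ← Measure.prod_restrict,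
    lintegral_prod_mul (μ := volume.restrict (Set.Ioi 0))
      (f := fun r => ENNReal.ofReal r * (gaussianPDF 0 1 r * gaussianPDF 0 1 0))
      (g := A.indicator fun _ => 1) (by fun_prop)
      ((measurable_const.indicator hA).aemeasurable)]
  congr 1
  rw [lintegral_indicator hA, setLIntegral_one, Measure.restrict_apply hA]

lemma planeGaussian_real_cone {S : Set (ℝ × ℝ)} (hS : MeasurableSet S) {A : Set ℝ}
    (hA : MeasurableSet A)
    (hSA : ∀ r > 0, ∀ φ ∈ Set.Ioo (-Real.pi) Real.pi,
      (r * Real.cos φ, r * Real.sin φ) ∈ S ↔ φ ∈ A) :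
    planeGaussian.real S = volume.real (A ∩ Set.Ioo (-Real.pi) Real.pi) / (2 * Real.pi) := by
  have h1 := planeGaussian_cone hS hA hSA
  -- The whole plane is a cone of angle `2π`, which determines the radial constant without computing
  -- the integral.
  have h2 := planeGaussian_cone MeasurableSet.univ MeasurableSet.univ (by simp)
  rw [measure_univ] at h2
  set C := ∫⁻ r in Set.Ioi 0, ENNReal.ofReal r * (gaussianPDF 0 1 r * gaussianPDF 0 1 0)
  have h3 := congrArg ENNReal.toReal h2
  have h4 := congrArg ENNReal.toReal h1
  rw [ENNReal.toReal_mul] at h3 h4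
  have h5 : (volume (Set.univ ∩ Set.Ioo (-Real.pi) Real.pi)).toReal = 2 * Real.pi := by
    rw [Set.univ_inter, Real.volume_Ioo, ENNReal.toReal_ofReal (by linarith [Real.pi_pos])]
    ring
  rw [h5, ENNReal.toReal_one] at h3
  have := Real.pi_pos
  rw [measureReal_def, measureReal_def, h4, eq_div_iff (by positivity), mul_right_comm, ← h3,
    one_mul]

/-- The two half-planes are `|φ| < π/2` and `|φ - θ| < π/2`; for `θ` in `[0, π]` they meet in a
sector of angle `π - θ`. -/
lemma planeGaussian_real_both_pos {θ : ℝ} (h0 : 0 ≤ θ) (h1 : θ ≤ Real.pi) :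
    planeGaussian.real {z | 0 < z.1 ∧ 0 < Real.cos θ * z.1 + Real.sin θ * z.2} =
      (1 - θ / Real.pi) / 2 := by
  have hpi := Real.pi_pos
  rw [planeGaussian_real_cone (A := Set.Ioo (θ - Real.pi / 2) (Real.pi / 2))
    (by measurability) measurableSet_Ioo]
  · rw [Set.inter_eq_left.2 (Set.Ioo_subset_Ioo (by linarith) (by linarith)),
      measureReal_def, Real.volume_Ioo, ENNReal.toReal_ofReal (by linarith)]
    field_simp
    ring
  · rintro r hr φ ⟨hφ1, hφ2⟩
    have e : Real.cos θ * (r * Real.cos φ) + Real.sin θ * (r * Real.sin φ) =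
        r * Real.cos (φ - θ) := by rw [Real.cos_sub]; ring
    simp only [Set.mem_ofPred_eq, e, mul_pos_iff_of_pos_left hr, Set.mem_Ioo]
    constructor
    · rintro ⟨ha, hb⟩
      have hφ3 : φ < Real.pi / 2 := by
        by_contra! h
        exact absurd (Real.cos_nonpos_of_pi_div_two_le_of_le h (by linarith)) (not_le.2 ha)
      refine ⟨?_, hφ3⟩
      have hφ4 : -(Real.pi / 2) < φ := by
        by_contra! h
        have := Real.cos_nonpos_of_pi_div_two_le_of_le (x := -φ) (by linarith) (by linarith)
        rw [Real.cos_neg] at this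
        exact absurd this (not_le.2 ha)
      by_contra! h
      have := Real.cos_nonpos_of_pi_div_two_le_of_le (x := -(φ - θ)) (by linarith) (by linarith)
      rw [Real.cos_neg] at this
      exact absurd this (not_le.2 hb)
    · rintro ⟨ha, hb⟩
      exact ⟨Real.cos_pos_of_mem_Ioo ⟨by linarith, by linarith⟩,
        Real.cos_pos_of_mem_Ioo ⟨by linarith, by linarith⟩⟩

/-- Since `cos² + sin² = 1`, the characteristic functions multiply to the standard one. This is used
to see that lines through the origin are null. -/
lemma map_planeGaussian_cos_sin (θ : ℝ) :
    planeGaussian.map (fun z => Real.cos θ * z.1 + Real.sin θ * z.2) = gaussianReal 0 1 := by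
  refine Measure.ext_of_charFun (funext fun t => ?_)
  rw [charFun_gaussianReal, charFun_apply_real, integral_map (by fun_prop) (by fun_prop)]
  have h : ∀ z : ℝ × ℝ, Complex.exp (t * ((Real.cos θ * z.1 + Real.sin θ * z.2 : ℝ) : ℂ) *
      Complex.I) = Complex.exp (((t * Real.cos θ : ℝ) : ℂ) * z.1 * Complex.I) *
        Complex.exp (((t * Real.sin θ : ℝ) : ℂ) * z.2 * Complex.I) := by
    intro z
    rw [← Complex.exp_add]
    push_cast
    ring_nf
  simp_rw [h]
  rw [integral_prod_mul (fun x : ℝ => Complex.exp (((t * Real.cos θ : ℝ) : ℂ) * x * Complex.I))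
    (fun x : ℝ => Complex.exp (((t * Real.sin θ : ℝ) : ℂ) * x * Complex.I)),
    ← charFun_apply_real, ← charFun_apply_real, charFun_gaussianReal, charFun_gaussianReal,
    ← Complex.exp_add]
  congr 1
  have := Complex.sin_sq_add_cos_sq (θ : ℂ)
  push_cast
  linear_combination (-(t : ℂ) ^ 2 / 2) * this

lemma planeGaussian_line_eq_zero (θ : ℝ) :
    planeGaussian {z | Real.cos θ * z.1 + Real.sin θ * z.2 = 0} = 0 := by
  have h := map_planeGaussian_cos_sin θ
  have : NullSingletonClass (gaussianReal 0 1) := nullSingletonClass_gaussianReal one_ne_zero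
  have h0 : gaussianReal 0 1 {0} = 0 := measure_singleton 0
  rw [← h, Measure.map_apply (by fun_prop) (measurableSet_singleton 0)] at h0
  exact h0

lemma map_neg_planeGaussian : planeGaussian.map (fun z => -z) = planeGaussian := by
  have h := Measure.map_prod_map (gaussianReal 0 1) (gaussianReal 0 1)
    (measurable_neg (G := ℝ)) (measurable_neg (G := ℝ))
  have h2 : (gaussianReal 0 1).map (Neg.neg) = gaussianReal 0 1 := by
    have := gaussianReal_map_neg (μ := 0) (v := 1)
    rwa [neg_zero] at this
  rw [h2] at h
  exact h.symm

/-- **Sheppard's formula**: two standard Gaussian variables with correlation `cos θ` have the same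
sign with probability `1 - θ / π`. -/
lemma planeGaussian_real_same_sign {θ : ℝ} (h0 : 0 ≤ θ) (h1 : θ ≤ Real.pi) :
    planeGaussian.real {z | 0 < z.1 ↔ 0 < Real.cos θ * z.1 + Real.sin θ * z.2} =
      1 - θ / Real.pi := by
  set P : Set (ℝ × ℝ) := {z | 0 < z.1 ∧ 0 < Real.cos θ * z.1 + Real.sin θ * z.2} with hP
  have hPm : MeasurableSet P := by measurability
  have hneg : planeGaussian.real ((fun z => -z) ⁻¹' P) = planeGaussian.real P := by
    conv_rhs => rw [← map_neg_planeGaussian]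
    rw [measureReal_def, measureReal_def, Measure.map_apply (by fun_prop) hPm]
  -- Equal bits means both positive or both nonpositive; replacing nonpositive by negative changes
  -- only the two null lines, and `-P` has the mass of `P` by symmetry.
  have hae : ({z | 0 < z.1 ↔ 0 < Real.cos θ * z.1 + Real.sin θ * z.2} : Set (ℝ × ℝ))
      =ᵐ[planeGaussian] (P ∪ (fun z => -z) ⁻¹' P : Set (ℝ × ℝ)) := by
    have e1 := measure_eq_zero_iff_ae_notMem.1 (planeGaussian_line_eq_zero θ)
    have e2 := measure_eq_zero_iff_ae_notMem.1 (planeGaussian_line_eq_zero 0)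
    filter_upwards [e1, e2] with z hz1 hz2
    replace hz1 : Real.cos θ * z.1 + Real.sin θ * z.2 ≠ 0 := hz1
    replace hz2 : z.1 ≠ 0 := by simpa using hz2
    refine propext ?_
    change (0 < z.1 ↔ 0 < Real.cos θ * z.1 + Real.sin θ * z.2) ↔
      ((0 < z.1 ∧ 0 < Real.cos θ * z.1 + Real.sin θ * z.2) ∨
        (0 < -z.1 ∧ 0 < Real.cos θ * (-z.1) + Real.sin θ * (-z.2)))
    have : Real.cos θ * (-z.1) + Real.sin θ * (-z.2) =
      -(Real.cos θ * z.1 + Real.sin θ * z.2) := by ring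
    rw [this]
    generalize Real.cos θ * z.1 + Real.sin θ * z.2 = y at hz1
    grind
  rw [measureReal_congr hae, measureReal_union _ (by measurability), hneg,
    planeGaussian_real_both_pos h0 h1]
  · ring
  · rw [Set.disjoint_left]
    rintro z ⟨hz, -⟩ ⟨hz', -⟩
    simp only [Prod.fst_neg] at hz'
    linarith

end

/-! ### Comparison of a product of averaged cosines with a Gaussian exponential -/

noncomputable section

/-- Telescoping: exchange one factor at a time, the remaining factors having absolute value at most
`1`. -/
lemma abs_prod_sub_prod_le_sum {ι : Type*} (s : Finset ι) (a b : ι → ℝ)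
    (ha : ∀ i ∈ s, |a i| ≤ 1) (hb : ∀ i ∈ s, |b i| ≤ 1) :
    |∏ i ∈ s, a i - ∏ i ∈ s, b i| ≤ ∑ i ∈ s, |a i - b i| := by
  classical
  induction s using Finset.induction_on with
  | empty => simp
  | insert i s his ih =>
    rw [Finset.prod_insert his, Finset.prod_insert his, Finset.sum_insert his]
    have e : a i * ∏ j ∈ s, a j - b i * ∏ j ∈ s, b j =
        (a i - b i) * ∏ j ∈ s, a j + b i * (∏ j ∈ s, a j - ∏ j ∈ s, b j) := by ring
    have hpa : |∏ j ∈ s, a j| ≤ 1 := by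
      rw [Finset.abs_prod]
      exact Finset.prod_le_one (fun _ _ => abs_nonneg _)
        fun j hj => ha j (Finset.mem_insert_of_mem hj)
    have ih' := ih (fun j hj => ha j (Finset.mem_insert_of_mem hj))
      (fun j hj => hb j (Finset.mem_insert_of_mem hj))
    rw [e]
    refine (abs_add_le _ _).trans (add_le_add ?_ ?_)
    · rw [abs_mul]
      exact mul_le_of_le_one_right (abs_nonneg _) hpa
    · rw [abs_mul]
      exact (mul_le_of_le_one_left (abs_nonneg _)
        (hb i (Finset.mem_insert_self i s))).trans ih'

/-- Taylor's bound covers `|x| ≤ 1`; beyond that the left side lies between `0` and `x²/2`. No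
smallness of `x` is needed, so the frequency can be arbitrary. -/
lemma abs_cos_sub_one_add_sq_le (x : ℝ) : |Real.cos x - 1 + x ^ 2 / 2| ≤ x ^ 4 / 2 := by
  rcases le_or_gt |x| 1 with h | h
  · have h1 := Real.cos_bound h
    have e : Real.cos x - 1 + x ^ 2 / 2 = Real.cos x - (1 - x ^ 2 / 2) := by ring
    have e4 : |x| ^ 4 = x ^ 4 := by rw [pow_abs, abs_of_nonneg (by positivity)]
    rw [e]
    rw [e4] at h1
    nlinarith [show 0 ≤ x ^ 4 by positivity]
  · have h1 := Real.one_sub_sq_div_two_le_cos (x := x)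
    rw [abs_of_nonneg (by linarith)]
    have h2 : 1 ≤ x ^ 2 := by rw [← sq_abs]; nlinarith
    nlinarith [Real.cos_le_one x]

lemma abs_one_sub_sub_exp_neg_le {y : ℝ} (hy : 0 ≤ y) : |1 - y - Real.exp (-y)| ≤ y ^ 2 := by
  have h1 := Real.add_one_le_exp (-y)
  rw [abs_of_nonpos (by linarith)]
  rcases le_or_gt y 1 with h | h
  · have := (abs_le.1 (Real.abs_exp_sub_one_sub_id_le (x := -y)
      (by rw [abs_neg, abs_of_nonneg hy]; exact h))).2
    nlinarith
  · have : Real.exp (-y) ≤ 1 := Real.exp_le_one_iff.2 (by linarith)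
    nlinarith

/-- The characteristic function of a count sketch is close to that of a Gaussian vector. -/
lemma abs_prod_cos_sub_exp_le {κ ι : Type*} [Fintype κ] [Fintype ι] {m : ℕ} (hm : 1 ≤ m)
    (hkm : Fintype.card κ ≤ m) (b : κ → ι → ℝ) (T : κ → ℝ) (N : ι → ℝ) {τ : ℝ}
    (hT : ∀ l, 0 ≤ T l) (hN : ∀ j, 0 ≤ N j) (hb : ∀ l j, b l j ^ 2 ≤ T l * N j)
    (hτ : ∀ j, m * N j ≤ τ) :
    |∏ j, (1 + (1 / m : ℝ) * ∑ l, (Real.cos (√m * b l j) - 1)) -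
      Real.exp (-(1 / 2) * ∑ j, ∑ l, b l j ^ 2)| ≤ (∑ l, T l) ^ 2 * τ * ∑ j, N j := by
  have hm0 : (0 : ℝ) < m := by exact_mod_cast hm
  have hm1 : (1 : ℝ) ≤ m := by exact_mod_cast hm
  set S := ∑ l, T l with hS
  have hS0 : 0 ≤ S := Finset.sum_nonneg fun l _ => hT l
  rw [Finset.mul_sum, Real.exp_sum]
  -- Each cosine factor lies in `[-1, 1]` because at most `m` terms, each in `[-2, 0]`, are averaged
  -- with weight `1/m`.
  refine (abs_prod_sub_prod_le_sum _ _ _ ?_ ?_).trans ?_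
  · intro j _
    have h1 : ∑ l, (Real.cos (√m * b l j) - 1) ≤ 0 :=
      Finset.sum_nonpos fun l _ => by linarith [Real.cos_le_one (√m * b l j)]
    have h2 : (Fintype.card κ : ℝ) * (-2) ≤ ∑ l, (Real.cos (√m * b l j) - 1) := by
      rw [← nsmul_eq_mul]
      exact Finset.card_nsmul_le_sum _ _ _ fun l _ => by
        linarith [Real.neg_one_le_cos (√m * b l j)]
    have h3 : (Fintype.card κ : ℝ) ≤ m := by exact_mod_cast hkm
    rw [abs_le, one_div, inv_mul_eq_div]
    constructor
    · have : -2 ≤ (∑ l, (Real.cos (√m * b l j) - 1)) / m := by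
        rw [le_div_iff₀ hm0]; linarith
      linarith
    · have : (∑ l, (Real.cos (√m * b l j) - 1)) / m ≤ 0 :=
        div_nonpos_of_nonpos_of_nonneg h1 hm0.le
      linarith
  · intro j _
    rw [abs_of_pos (Real.exp_pos _), Real.exp_le_one_iff]
    have : 0 ≤ ∑ l, b l j ^ 2 := Finset.sum_nonneg fun l _ => sq_nonneg _
    linarith
  rw [Finset.mul_sum]
  refine Finset.sum_le_sum fun j _ => ?_
  set y := (1 / 2) * ∑ l, b l j ^ 2 with hy
  have hy0 : 0 ≤ y := by positivity
  have hyS : y ≤ S * N j / 2 := by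
    have : ∑ l, b l j ^ 2 ≤ S * N j := by
      rw [hS, Finset.sum_mul]
      exact Finset.sum_le_sum fun l _ => hb l j
    linarith
  -- The quadratic parts of the cosines add up to exactly `y`. Of the two errors left, the quartic
  -- Taylor remainder and `1 - y - exp (-y)`, each takes half of the allowed bound.
  have e1 : 1 + (1 / m : ℝ) * ∑ l, (Real.cos (√m * b l j) - 1) - Real.exp (-(1 / 2) *
      ∑ l, b l j ^ 2) = (1 / m : ℝ) * ∑ l, (Real.cos (√m * b l j) - 1 + (√m * b l j) ^ 2 / 2) +
        (1 - y - Real.exp (-y)) := by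
    have : ∀ l, (√m * b l j) ^ 2 = m * b l j ^ 2 := fun l => by
      rw [mul_pow, Real.sq_sqrt hm0.le]
    simp_rw [this, Finset.sum_add_distrib, ← Finset.sum_div, ← Finset.mul_sum]
    rw [neg_mul, hy]
    field_simp
    ring
  rw [e1]
  have h1 : |(1 / m : ℝ) * ∑ l, (Real.cos (√m * b l j) - 1 + (√m * b l j) ^ 2 / 2)| ≤
      S ^ 2 * τ * N j / 2 := by
    rw [abs_mul, abs_of_pos (by positivity)]
    have h2 : ∀ l, |Real.cos (√m * b l j) - 1 + (√m * b l j) ^ 2 / 2| ≤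
        m * (τ * N j / 2) * (T l * S) := by
      intro l
      refine (abs_cos_sub_one_add_sq_le _).trans ?_
      have e : (√m * b l j) ^ 4 = m ^ 2 * (b l j ^ 2) ^ 2 := by
        rw [mul_pow, show √(m : ℝ) ^ 4 = (√(m : ℝ) ^ 2) ^ 2 by ring, Real.sq_sqrt hm0.le]
        ring
      rw [e]
      have h3 : (b l j ^ 2) ^ 2 ≤ (T l * N j) ^ 2 := pow_le_pow_left₀ (sq_nonneg _) (hb l j) 2
      have h4 : T l ≤ S := Finset.single_le_sum (fun i _ => hT i) (Finset.mem_univ l)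
      calc (m : ℝ) ^ 2 * (b l j ^ 2) ^ 2 / 2 ≤ m ^ 2 * (T l * N j) ^ 2 / 2 := by gcongr
        _ = m * ((m * N j) * N j / 2) * (T l * T l) := by ring
        _ ≤ m * (τ * N j / 2) * (T l * S) := by
          have := hT l
          have := hN j
          have := hτ j
          have : 0 ≤ τ := le_trans (by positivity) (hτ j)
          gcongr
    calc (1 / m : ℝ) * |∑ l, (Real.cos (√m * b l j) - 1 + (√m * b l j) ^ 2 / 2)|
        ≤ (1 / m : ℝ) * ∑ l, m * (τ * N j / 2) * (T l * S) := by
          gcongr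
          exact (Finset.abs_sum_le_sum_abs _ _).trans (Finset.sum_le_sum fun l _ => h2 l)
      _ = S ^ 2 * τ * N j / 2 := by
          rw [← Finset.mul_sum, ← Finset.sum_mul, ← hS]
          field_simp
  have h2 : |1 - y - Real.exp (-y)| ≤ S ^ 2 * τ * N j / 2 := by
    refine (abs_one_sub_sub_exp_neg_le hy0).trans ?_
    have hNτ : N j ≤ τ := le_trans (by nlinarith [hN j]) (hτ j)
    have := hN j
    calc y ^ 2 ≤ (S * N j / 2) ^ 2 := pow_le_pow_left₀ hy0 hyS 2
      _ = S ^ 2 * N j * N j / 4 := by ring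
      _ ≤ S ^ 2 * τ * N j / 4 := by gcongr
      _ ≤ S ^ 2 * τ * N j / 2 := by
        have : 0 ≤ τ := this.trans hNτ
        have : 0 ≤ S ^ 2 * τ * N j := by positivity
        linarith
  linarith [abs_add_le ((1 / m : ℝ) * ∑ l, (Real.cos (√m * b l j) - 1 +
    (√m * b l j) ^ 2 / 2)) (1 - y - Real.exp (-y))]

end

/-! ### The exact characteristic function of the count sketch -/

noncomputable section

instance : MeasurableSingletonClass ℤˣ where
  measurableSet_singleton σ := by
    refine ⟨{(σ : ℤ)}, measurableSet_singleton _, ?_⟩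
    ext τ
    simp [Units.ext_iff]

/-- A space of `k`-tuples of points in the plane. -/
abbrev PlaneTuple (k : ℕ) := PiLp 2 (fun _ : Fin k => WithLp 2 (ℝ × ℝ))

/-- The values of the count sketches of `p` and `q` at `k` given indices, rescaled by `√m`. -/
def scaledSketch {d m k : ℕ} (p q : EuclideanSpace ℝ (Fin d)) (i : Fin k → Fin m)
    (h : Fin d → Fin m) (s : Fin d → ℤˣ) : PlaneTuple k :=
  WithLp.toLp 2 fun l => WithLp.toLp 2
    (√m * countSketch h s p (i l), √m * countSketch h s q (i l))

variable {Ω : Type*} [MeasurableSpace Ω] {μ : Measure Ω} {d m k : ℕ}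
  {h : Fin d → Ω → Fin m} {s : Fin d → Ω → ℤˣ}

lemma IsCountSketchHash.measurable_pair (H : IsCountSketchHash μ h s) (j : Fin d) :
    Measurable fun ω => (h j ω, s j ω) :=
  (H.measurable_h j).prodMk (H.measurable_s j)

lemma IsCountSketchHash.measurable_comp (H : IsCountSketchHash μ h s) {E : Type*}
    [MeasurableSpace E] (F : (Fin d → Fin m) → (Fin d → ℤˣ) → E) :
    Measurable fun ω => F (fun j => h j ω) (fun j => s j ω) := by
  have h1 : Measurable fun ω => ((fun j => h j ω), (fun j => s j ω)) :=
    (measurable_pi_lambda _ H.measurable_h).prodMk (measurable_pi_lambda _ H.measurable_s)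
  exact (measurable_of_countable fun x : (Fin d → Fin m) × (Fin d → ℤˣ) => F x.1 x.2).comp h1

lemma IsCountSketchHash.map_pair_real_singleton (H : IsCountSketchHash μ h s) (j : Fin d)
    (r : Fin m) (σ : ℤˣ) :
    (μ.map fun ω => (h j ω, s j ω)).real {(r, σ)} = 1 / m * (1 / 2) := by
  rw [measureReal_def, Measure.map_apply (H.measurable_pair j) (measurableSet_singleton _)]
  have e : (fun ω => (h j ω, s j ω)) ⁻¹' {(r, σ)} = h j ⁻¹' {r} ∩ s j ⁻¹' {σ} := by
    ext ω
    simp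
  rw [e, (H.indep_h_s j).measure_inter_preimage_eq_mul _ _ (measurableSet_singleton _)
    (measurableSet_singleton _), ENNReal.toReal_mul]
  exact congrArg₂ (· * ·) (H.uniform_h j r) (H.uniform_s j σ)

/-- Bins outside the range of `i` contribute `cos 0 = 1`, so only the selected bins deviate from the
mean `1`. -/
lemma sum_cos_ite_eq {κ : Type*} [Fintype κ] (hm : 1 ≤ m) {i : κ → Fin m}
    (hi : Function.Injective i) (b : κ → ℝ) (c : ℝ) :
    (1 / m : ℝ) * ∑ r : Fin m, Real.cos (c * ∑ l, if r = i l then b l else 0) =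
      1 + (1 / m : ℝ) * ∑ l, (Real.cos (c * b l) - 1) := by
  have hm0 : (m : ℝ) ≠ 0 := by
    have : (0 : ℝ) < m := by exact_mod_cast hm
    exact this.ne'
  have h1 : ∑ l, (Real.cos (c * b l) - 1) =
      ∑ r : Fin m, (Real.cos (c * ∑ l, if r = i l then b l else 0) - 1) := by
    refine Finset.sum_of_injOn i hi.injOn (fun _ _ => Finset.mem_coe.2 (Finset.mem_univ _)) ?_ ?_
    · intro r _ hr
      have : ∀ l, r ≠ i l := fun l hl => hr ⟨l, by simp, hl.symm⟩
      simp [this]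
    · intro l _
      have : ∑ l', (if i l = i l' then b l' else 0) = b l := by
        rw [Finset.sum_eq_single l]
        · simp
        · intro l' _ hl'
          rw [if_neg fun h => hl' (hi h).symm]
        · simp
      rw [this]
  rw [h1, Finset.sum_sub_distrib]
  simp only [Finset.sum_const, Finset.card_univ, Fintype.card_fin, nsmul_eq_mul, mul_one]
  field_simp
  ring

/-- Averaging over the sign turns the exponential into a cosine; averaging over the bin gives the
weight `1/m`. -/
lemma IsCountSketchHash.integral_exp_coordinate [IsProbabilityMeasure μ]
    (H : IsCountSketchHash μ h s) (j : Fin d) (a : Fin m → ℝ) :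
    ∫ ω, Complex.exp (((((s j ω : ℤˣ) : ℤ) : ℝ) * a (h j ω) : ℝ) * Complex.I) ∂μ =
      ((1 / m * ∑ r, Real.cos (a r) : ℝ) : ℂ) := by
  have := Measure.isProbabilityMeasure_map (μ := μ) (H.measurable_pair j).aemeasurable
  let F : Fin m × ℤˣ → ℂ := fun x =>
    Complex.exp ((((x.2 : ℤ) : ℝ) * a x.1 : ℝ) * Complex.I)
  have h1 : ∫ ω, F (h j ω, s j ω) ∂μ = ∫ x, F x ∂(μ.map fun ω => (h j ω, s j ω)) :=
    (integral_map (H.measurable_pair j).aemeasurable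
      (measurable_of_countable F).aestronglyMeasurable).symm
  change ∫ ω, F (h j ω, s j ω) ∂μ = _
  rw [h1, integral_fintype .of_finite, Fintype.sum_prod_type]
  push_cast
  rw [Finset.mul_sum]
  refine Finset.sum_congr rfl fun r _ => ?_
  simp_rw [H.map_pair_real_singleton]
  have : (Finset.univ : Finset ℤˣ) = {1, -1} := by decide
  rw [this, Finset.sum_pair (by decide), Complex.cos]
  simp only [F, Complex.real_smul]
  push_cast
  ring_nf

/-- Reordering the sum by coordinate makes the `j`-th term depend on `(h j, s j)` alone, the form to
which independence applies. -/
lemma inner_scaledSketch (p q : EuclideanSpace ℝ (Fin d)) (i : Fin k → Fin m)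
    (h : Fin d → Fin m) (s : Fin d → ℤˣ) (t : PlaneTuple k) :
    inner ℝ (scaledSketch p q i h s) t = ∑ j, ((s j : ℤ) : ℝ) *
      (√m * ∑ l, if h j = i l then p j * (t l).fst + q j * (t l).snd else 0) := by
  simp only [scaledSketch, PiLp.inner_apply, WithLp.prod_inner_apply, countSketch,
    Finset.sum_filter, Finset.mul_sum, RCLike.inner_apply, conj_trivial]
  rw [Finset.sum_comm]
  refine Finset.sum_congr rfl fun l _ => ?_
  rw [← Finset.sum_add_distrib]
  refine Finset.sum_congr rfl fun j _ => ?_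
  split_ifs
  · simp only [WithLp.fst, WithLp.snd]
    ring
  · simp

lemma IsCountSketchHash.charFun_map_scaledSketch [IsProbabilityMeasure μ]
    (H : IsCountSketchHash μ h s) (hm : 1 ≤ m) (p q : EuclideanSpace ℝ (Fin d))
    {i : Fin k → Fin m} (hi : Function.Injective i) (t : PlaneTuple k) :
    charFun (μ.map fun ω => scaledSketch p q i (fun j => h j ω) (fun j => s j ω)) t =
      ((∏ j, (1 + (1 / m : ℝ) * ∑ l, (Real.cos (√m *
        (p j * (t l).fst + q j * (t l).snd)) - 1)) : ℝ) : ℂ) := by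
  rw [charFun_apply, integral_map (H.measurable_comp (scaledSketch p q i)).aemeasurable
    (by fun_prop)]
  simp_rw [inner_scaledSketch]
  let F : Fin d → Fin m × ℤˣ → ℂ := fun j x => Complex.exp ((((x.2 : ℤ) : ℝ) *
    (√m * ∑ l, if x.1 = i l then p j * (t l).fst + q j * (t l).snd else 0) : ℝ) * Complex.I)
  have h1 := H.iIndep.integral_fun_prod_comp (f := F)
    (fun j => (H.measurable_pair j).aemeasurable)
    (fun j => (measurable_of_countable (F j)).aestronglyMeasurable)
  have h2 : ∀ ω, Complex.exp (((∑ j, ((s j ω : ℤ) : ℝ) * (√m * ∑ l, if h j ω = i l then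
      p j * (t l).fst + q j * (t l).snd else 0) : ℝ) : ℂ) * Complex.I) =
      ∏ j, F j (h j ω, s j ω) := by
    intro ω
    rw [← Complex.exp_sum, ← Finset.sum_mul]
    push_cast
    rfl
  simp_rw [h2]
  rw [h1]
  rw [Complex.ofReal_prod]
  refine Finset.prod_congr rfl fun j _ => ?_
  have h3 := H.integral_exp_coordinate j
    fun r => √m * ∑ l, if r = i l then p j * (t l).fst + q j * (t l).snd else 0
  rw [sum_cos_ite_eq hm hi] at h3
  exact h3

end

/-! ### The Gaussian limit and its sign event -/

noncomputable section

/-- The law of two standard Gaussian variables with correlation `cos θ`. -/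
def gaussianPair (θ : ℝ) : Measure (WithLp 2 (ℝ × ℝ)) :=
  planeGaussian.map fun z => WithLp.toLp 2 (z.1, Real.cos θ * z.1 + Real.sin θ * z.2)

/-- The law of `k` independent pairs of standard Gaussian variables with correlation `cos θ`. -/
def gaussianTuple (θ : ℝ) (k : ℕ) : Measure (PlaneTuple k) :=
  (Measure.pi fun _ => gaussianPair θ).map (WithLp.toLp 2)

/-- The `k`-tuples of pairs such that both entries of each pair have the same sign bit. -/
def sameSign (k : ℕ) : Set (PlaneTuple k) := {w | ∀ l, 0 < (w l).fst ↔ 0 < (w l).snd}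

lemma measurable_gaussianPair_map (θ : ℝ) : Measurable fun z : ℝ × ℝ =>
    (WithLp.toLp 2 (z.1, Real.cos θ * z.1 + Real.sin θ * z.2) : WithLp 2 (ℝ × ℝ)) := by
  fun_prop

instance (θ : ℝ) : IsProbabilityMeasure (gaussianPair θ) :=
  Measure.isProbabilityMeasure_map (measurable_gaussianPair_map θ).aemeasurable

instance (θ : ℝ) (k : ℕ) : IsProbabilityMeasure (gaussianTuple θ k) :=
  Measure.isProbabilityMeasure_map (by fun_prop)

lemma charFun_gaussianPair (θ : ℝ) (t : WithLp 2 (ℝ × ℝ)) :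
    charFun (gaussianPair θ) t = ((Real.exp (-(1 / 2) *
      (t.fst ^ 2 + 2 * Real.cos θ * (t.fst * t.snd) + t.snd ^ 2)) : ℝ) : ℂ) := by
  rw [gaussianPair, charFun_apply,
    integral_map (measurable_gaussianPair_map θ).aemeasurable (by fun_prop)]
  have h : ∀ z : ℝ × ℝ, Complex.exp ((inner ℝ (WithLp.toLp 2
      (z.1, Real.cos θ * z.1 + Real.sin θ * z.2) : WithLp 2 (ℝ × ℝ)) t : ℝ) * Complex.I) =
      Complex.exp (((t.fst + t.snd * Real.cos θ : ℝ) : ℂ) * z.1 * Complex.I) *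
        Complex.exp (((t.snd * Real.sin θ : ℝ) : ℂ) * z.2 * Complex.I) := by
    intro z
    rw [← Complex.exp_add, WithLp.prod_inner_apply]
    simp only [RCLike.inner_apply, conj_trivial, WithLp.fst, WithLp.snd]
    push_cast
    ring_nf
  simp_rw [h]
  rw [integral_prod_mul (fun x : ℝ => Complex.exp (((t.fst + t.snd * Real.cos θ : ℝ) : ℂ) * x *
    Complex.I)) (fun x : ℝ => Complex.exp (((t.snd * Real.sin θ : ℝ) : ℂ) * x * Complex.I)),
    ← charFun_apply_real, ← charFun_apply_real, charFun_gaussianReal, charFun_gaussianReal,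
    ← Complex.exp_add, Complex.ofReal_exp]
  congr 1
  have := Complex.sin_sq_add_cos_sq (θ : ℂ)
  push_cast
  linear_combination (-(t.snd : ℂ) ^ 2 / 2) * this

lemma charFun_gaussianTuple (θ : ℝ) {k : ℕ} (t : PlaneTuple k) :
    charFun (gaussianTuple θ k) t = ((Real.exp (-(1 / 2) * ∑ l, ((t l).fst ^ 2 +
      2 * Real.cos θ * ((t l).fst * (t l).snd) + (t l).snd ^ 2)) : ℝ) : ℂ) := by
  rw [gaussianTuple, charFun_pi]
  simp_rw [charFun_gaussianPair]
  rw [Finset.mul_sum, Real.exp_sum, Complex.ofReal_prod]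

lemma measurableSet_sameSign (k : ℕ) : MeasurableSet (sameSign k) := by
  have a : ∀ l, MeasurableSet {w : PlaneTuple k | 0 < (w l).fst} := fun l =>
    measurableSet_lt measurable_const (Continuous.measurable (by fun_prop))
  have b : ∀ l, MeasurableSet {w : PlaneTuple k | 0 < (w l).snd} := fun l =>
    measurableSet_lt measurable_const (Continuous.measurable (by fun_prop))
  have e : sameSign k = ⋂ l, {w : PlaneTuple k | 0 < (w l).fst ↔ 0 < (w l).snd} := by
    ext w
    simp [sameSign]
  rw [e]
  exact MeasurableSet.iInter fun l => (a l).iff (b l)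

lemma gaussianTuple_real_sameSign {θ : ℝ} (h0 : 0 ≤ θ) (h1 : θ ≤ Real.pi) (k : ℕ) :
    (gaussianTuple θ k).real (sameSign k) = (1 - θ / Real.pi) ^ k := by
  have hm : MeasurableSet {w : WithLp 2 (ℝ × ℝ) | 0 < w.fst ↔ 0 < w.snd} := by
    have a : MeasurableSet {w : WithLp 2 (ℝ × ℝ) | 0 < w.fst} :=
      measurableSet_lt measurable_const (by fun_prop)
    have b : MeasurableSet {w : WithLp 2 (ℝ × ℝ) | 0 < w.snd} :=
      measurableSet_lt measurable_const (by fun_prop)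
    exact a.iff b
  have e : (WithLp.toLp 2 : (Fin k → WithLp 2 (ℝ × ℝ)) → PlaneTuple k) ⁻¹' sameSign k =
      Set.univ.pi fun _ => {w : WithLp 2 (ℝ × ℝ) | 0 < w.fst ↔ 0 < w.snd} := by
    ext w
    simp [sameSign]
  rw [measureReal_def, gaussianTuple, Measure.map_apply (by fun_prop) (measurableSet_sameSign k), e, Measure.pi_pi,
    Finset.prod_const, Finset.card_univ, Fintype.card_fin, ENNReal.toReal_pow]
  congr 1
  rw [gaussianPair, Measure.map_apply (measurable_gaussianPair_map θ) hm]
  exact planeGaussian_real_same_sign h0 h1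

/-- Away from the coordinate hyperplanes every sign is locally constant, and so is membership in the
event. -/
lemma frontier_sameSign_subset (k : ℕ) :
    frontier (sameSign k) ⊆ ⋃ l, {w | (w l).fst = 0} ∪ {w | (w l).snd = 0} := by
  intro w hw
  by_contra hU
  simp only [Set.mem_iUnion, Set.mem_union, Set.mem_ofPred_eq, not_exists, not_or] at hU
  have key : ∀ f : PlaneTuple k → ℝ, Continuous f → f w ≠ 0 →
      ∀ᶠ w' in 𝓝 w, (0 < f w' ↔ 0 < f w) := by
    intro f hf h0
    rcases lt_or_gt_of_ne h0 with h | h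
    · filter_upwards [hf.continuousAt.eventually_lt continuousAt_const h] with w' hw'
      exact ⟨fun h' => absurd h' hw'.not_gt, fun h' => absurd h' h.not_gt⟩
    · filter_upwards [continuousAt_const.eventually_lt hf.continuousAt h] with w' hw'
      exact ⟨fun _ => h, fun _ => hw'⟩
  have h1 : ∀ᶠ w' in 𝓝 w, (w' ∈ sameSign k ↔ w ∈ sameSign k) := by
    have h2 : ∀ᶠ w' in 𝓝 w, ∀ l, (0 < (w' l).fst ↔ 0 < (w l).fst) ∧
        (0 < (w' l).snd ↔ 0 < (w l).snd) :=
      eventually_all.2 fun l => (key (fun w => (w l).fst) (by fun_prop) (hU l).1).and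
        (key (fun w => (w l).snd) (by fun_prop) (hU l).2)
    filter_upwards [h2] with w' hw'
    exact forall_congr' fun l => by rw [(hw' l).1, (hw' l).2]
  by_cases hA : w ∈ sameSign k
  · exact hw.2 (mem_interior_iff_mem_nhds.2 (h1.mono fun w' h' => h'.2 hA))
  · obtain ⟨w', h', h''⟩ := (mem_closure_iff_frequently.1 hw.1).and_eventually h1 |>.exists
    exact hA (h''.1 h')

lemma gaussianTuple_frontier_sameSign (θ : ℝ) (k : ℕ) :
    gaussianTuple θ k (frontier (sameSign k)) = 0 := by
  refine measure_mono_null (frontier_sameSign_subset k) (measure_iUnion_null fun l => ?_)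
  have e : ∀ f : WithLp 2 (ℝ × ℝ) → ℝ, Continuous f →
      planeGaussian {z | f (WithLp.toLp 2 (z.1, Real.cos θ * z.1 + Real.sin θ * z.2)) = 0} = 0 →
      gaussianTuple θ k {w | f (w l) = 0} = 0 := by
    intro f hf h0
    have hfm : MeasurableSet {w | f w = 0} := hf.measurable (measurableSet_singleton 0)
    have hfm' : MeasurableSet {w : PlaneTuple k | f (w l) = 0} :=
      (show Measurable fun w : PlaneTuple k => f (w l) from
        Continuous.measurable (by fun_prop)) (measurableSet_singleton 0)
    have h1 : gaussianPair θ {w | f w = 0} = 0 := by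
      rw [gaussianPair, Measure.map_apply (measurable_gaussianPair_map θ) hfm]
      exact h0
    rw [gaussianTuple, Measure.map_apply (by fun_prop) hfm']
    exact (measurePreserving_eval (fun _ : Fin k => gaussianPair θ) l).measure_preimage
      hfm.nullMeasurableSet |>.trans h1
  refine measure_union_null (e (fun w => w.fst) (by fun_prop) ?_)
    (e (fun w => w.snd) (by fun_prop) (planeGaussian_line_eq_zero θ))
  have := planeGaussian_line_eq_zero 0
  simpa using this

lemma tendsto_real_sameSign {k : ℕ} {θ : ℝ} (h0 : 0 ≤ θ) (h1 : θ ≤ Real.pi)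
    (ν : ℕ → ProbabilityMeasure (PlaneTuple k))
    (h : ∀ t, Tendsto (fun n => charFun (ν n : Measure (PlaneTuple k)) t) atTop
      (𝓝 (charFun (gaussianTuple θ k) t))) :
    Tendsto (fun n => (ν n : Measure (PlaneTuple k)).real (sameSign k)) atTop
      (𝓝 ((1 - θ / Real.pi) ^ k)) := by
  have h2 := ProbabilityMeasure.tendsto_of_tendsto_charFun
    (μ₀ := ⟨gaussianTuple θ k, inferInstance⟩) h
  have h3 := ProbabilityMeasure.tendsto_measure_of_null_frontier_of_tendsto' h2
    (gaussianTuple_frontier_sameSign θ k)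
  rw [← gaussianTuple_real_sameSign h0 h1]
  exact (ENNReal.tendsto_toReal (measure_ne_top _ _)).comp h3

/-- If the characteristic function of a law is close to that of `k` independent Gaussian pairs
with correlation `cos θ`, then all `k` pairs have the same sign with probability close to
`(1 - θ / π) ^ k`, uniformly in `θ`. -/
lemma exists_pos_abs_real_sameSign_sub_le (k : ℕ) {ε : ℝ} (hε : 0 < ε) :
    ∃ τ > 0, ∀ (ν : ProbabilityMeasure (PlaneTuple k)) (θ : ℝ), 0 ≤ θ → θ ≤ Real.pi →
      (∀ t, ‖charFun (ν : Measure (PlaneTuple k)) t - charFun (gaussianTuple θ k) t‖ ≤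
        (∑ l, ((t l).fst ^ 2 + (t l).snd ^ 2)) ^ 2 * τ) →
      |(ν : Measure (PlaneTuple k)).real (sameSign k) - (1 - θ / Real.pi) ^ k| ≤ ε := by
  -- Counterexamples with `τ = 1/(n+1)` have angles subconverging to some `θ'`. Along that
  -- subsequence the characteristic functions converge to those for `θ'`, so both probabilities have
  -- the same limit.
  by_contra! hcon
  choose ν θ hθ0 hθ1 hclose hfar using fun n : ℕ => hcon (1 / ((n : ℝ) + 1)) (by positivity)
  obtain ⟨θ', hθ', φ, hφ, hlim⟩ :=
    isCompact_Icc.tendsto_subseq fun n => (⟨hθ0 n, hθ1 n⟩ : θ n ∈ Set.Icc 0 Real.pi)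
  have hφt := hφ.tendsto_atTop
  have h1 : Tendsto (fun n => (ν (φ n) : Measure (PlaneTuple k)).real (sameSign k)) atTop
      (𝓝 ((1 - θ' / Real.pi) ^ k)) := by
    refine tendsto_real_sameSign hθ'.1 hθ'.2 (fun n => ν (φ n)) fun t => ?_
    have h2 : Tendsto (fun n => charFun (gaussianTuple (θ (φ n)) k) t) atTop
        (𝓝 (charFun (gaussianTuple θ' k) t)) := by
      simp_rw [charFun_gaussianTuple]
      have hc : Continuous fun x : ℝ => ((Real.exp (-(1 / 2) * ∑ l, ((t l).fst ^ 2 +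
        2 * Real.cos x * ((t l).fst * (t l).snd) + (t l).snd ^ 2)) : ℝ) : ℂ) := by fun_prop
      exact (hc.tendsto θ').comp hlim
    have h3 : Tendsto (fun n => charFun (ν (φ n) : Measure (PlaneTuple k)) t -
        charFun (gaussianTuple (θ (φ n)) k) t) atTop (𝓝 0) := by
      have h4 : Tendsto (fun n => (∑ l, ((t l).fst ^ 2 + (t l).snd ^ 2)) ^ 2 *
          (1 / ((φ n : ℝ) + 1))) atTop (𝓝 0) := by
        have := (tendsto_one_div_add_atTop_nhds_zero_nat (𝕜 := ℝ)).comp hφt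
        simpa using this.const_mul ((∑ l, ((t l).fst ^ 2 + (t l).snd ^ 2)) ^ 2)
      exact squeeze_zero_norm (fun n => hclose (φ n) t) h4
    simpa using h3.add h2
  have h2 : Tendsto (fun n => (1 - θ (φ n) / Real.pi) ^ k) atTop
      (𝓝 ((1 - θ' / Real.pi) ^ k)) :=
    ((hlim.div_const Real.pi).const_sub 1).pow k
  have h3 := (h1.sub h2).abs
  rw [sub_self, abs_zero] at h3
  obtain ⟨n, hn⟩ := (h3.eventually_lt_const hε).exists
  exact absurd hn (hfar (φ n)).not_gt

end

/-! ### Collision probabilities for vectors without dominant coordinates -/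

noncomputable section

lemma signBit_eq_signBit_iff (x y : ℝ) : signBit x = signBit y ↔ (0 < x ↔ 0 < y) := by
  unfold signBit
  split_ifs with h h' h' <;> simp [h, h']

lemma countSketch_smul {d m : ℕ} (h : Fin d → Fin m) (s : Fin d → ℤˣ) (c : ℝ)
    (p : EuclideanSpace ℝ (Fin d)) (l : Fin m) :
    countSketch h s (c • p) l = c * countSketch h s p l := by
  simp only [countSketch, PiLp.smul_apply, smul_eq_mul, Finset.mul_sum]
  exact Finset.sum_congr rfl fun j _ => by ring

lemma theta_mem_Icc {d : ℕ} (u v : EuclideanSpace ℝ (Fin d)) :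
    theta u v ∈ Set.Icc 0 Real.pi :=
  ⟨Real.arccos_nonneg _, Real.arccos_le_pi _⟩

lemma cos_theta {d : ℕ} (u v : EuclideanSpace ℝ (Fin d)) : Real.cos (theta u v) = cosSim u v := by
  have h := abs_le.1 (abs_real_inner_div_norm_mul_norm_le_one u v)
  exact Real.cos_arccos h.1 h.2

/-- The event that `u` and `v` have the same hash bits at `k` distinct indices has probability
close to `(1 - θ / π) ^ k` if no coordinate dominates `u` or `v`. -/
lemma exists_pos_abs_collision_sub_le (k : ℕ) {ε : ℝ} (hε : 0 < ε) :
    ∃ τ > 0, ∀ {Ω : Type*} [MeasurableSpace Ω] (μ : Measure Ω) [IsProbabilityMeasure μ]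
      {d m : ℕ} {h : Fin d → Ω → Fin m} {s : Fin d → Ω → ℤˣ}, IsCountSketchHash μ h s → 1 ≤ m →
      ∀ u v : EuclideanSpace ℝ (Fin d), u ≠ 0 → v ≠ 0 →
      (∀ j, m * (u j ^ 2 / ‖u‖ ^ 2 + v j ^ 2 / ‖v‖ ^ 2) ≤ τ) →
      ∀ i : Fin k → Fin m, Function.Injective i →
      |μ.real {ω | ∀ l, csSRP (fun j => h j ω) (fun j => s j ω) u (i l) =
          csSRP (fun j => h j ω) (fun j => s j ω) v (i l)} - (1 - theta u v / Real.pi) ^ k| ≤ ε := by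
  obtain ⟨τ, hτ, key⟩ := exists_pos_abs_real_sameSign_sub_le k hε
  -- The halving absorbs `∑ j, (p j ^ 2 + q j ^ 2) = 2` for the unit vectors `p`, `q`; normalising
  -- does not affect the sign bits.
  refine ⟨τ / 2, by positivity, ?_⟩
  intro Ω _ μ _ d m h s H hm u v hu hv huv i hi
  have hm0 : (0 : ℝ) < m := by exact_mod_cast hm
  have hu0 := norm_pos_iff.2 hu
  have hv0 := norm_pos_iff.2 hv
  set p : EuclideanSpace ℝ (Fin d) := ‖u‖⁻¹ • u with hp
  set q : EuclideanSpace ℝ (Fin d) := ‖v‖⁻¹ • v with hq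
  have hY := H.measurable_comp (scaledSketch p q i)
  have hνp : IsProbabilityMeasure
      (μ.map fun ω => scaledSketch p q i (fun j => h j ω) (fun j => s j ω)) :=
    Measure.isProbabilityMeasure_map hY.aemeasurable
  have hpj : ∀ j, p j ^ 2 = u j ^ 2 / ‖u‖ ^ 2 := fun j => by
    simp only [hp, PiLp.smul_apply, smul_eq_mul]
    field_simp
  have hqj : ∀ j, q j ^ 2 = v j ^ 2 / ‖v‖ ^ 2 := fun j => by
    simp only [hq, PiLp.smul_apply, smul_eq_mul]
    field_simp
  have hp1 : ∑ j, p j ^ 2 = 1 := by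
    simp_rw [hpj, ← Finset.sum_div, ← EuclideanSpace.real_norm_sq_eq]
    field_simp
  have hq1 : ∑ j, q j ^ 2 = 1 := by
    simp_rw [hqj, ← Finset.sum_div, ← EuclideanSpace.real_norm_sq_eq]
    field_simp
  have hpq : ∑ j, p j * q j = Real.cos (theta u v) := by
    rw [cos_theta, cosSim, PiLp.inner_apply, Finset.sum_div]
    refine Finset.sum_congr rfl fun j _ => ?_
    simp only [hp, hq, PiLp.smul_apply, smul_eq_mul, RCLike.inner_apply, conj_trivial]
    field_simp
  have h1 := key ⟨_, hνp⟩ (theta u v) (theta_mem_Icc u v).1 (theta_mem_Icc u v).2 ?_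
  · convert h1 using 3
    change _ = (μ.map fun ω => scaledSketch p q i (fun j => h j ω) (fun j => s j ω)).real _
    rw [measureReal_def, measureReal_def, Measure.map_apply hY (measurableSet_sameSign k)]
    congr 2
    ext ω
    refine forall_congr' fun l => ?_
    have hsq : 0 < √(m : ℝ) := Real.sqrt_pos.2 hm0
    simp only [csSRP, signBit_eq_signBit_iff, scaledSketch, WithLp.fst, WithLp.snd,
      mul_pos_iff_of_pos_left hsq, hp, hq, countSketch_smul,
      mul_pos_iff_of_pos_left (inv_pos.2 hu0), mul_pos_iff_of_pos_left (inv_pos.2 hv0)]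
  · intro t
    change ‖charFun (μ.map fun ω => scaledSketch p q i (fun j => h j ω) (fun j => s j ω)) t -
      _‖ ≤ _
    rw [H.charFun_map_scaledSketch hm p q hi t, charFun_gaussianTuple, ← Complex.ofReal_sub,
      Complex.norm_real, Real.norm_eq_abs]
    have h2 := abs_prod_cos_sub_exp_le hm (by simpa using Fintype.card_le_of_injective i hi)
      (fun l j => p j * (t l).fst + q j * (t l).snd) (fun l => (t l).fst ^ 2 + (t l).snd ^ 2)
      (fun j => p j ^ 2 + q j ^ 2) (τ := τ / 2) (fun l => by positivity) (fun j => by positivity)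
      -- Cauchy–Schwarz in the plane, through Lagrange's identity.
      (fun l j => by nlinarith [sq_nonneg (p j * (t l).snd - q j * (t l).fst)])
      (fun j => by rw [hpj, hqj]; exact huv j)
    have e : ∑ j, ∑ l, (p j * (t l).fst + q j * (t l).snd) ^ 2 = ∑ l, ((t l).fst ^ 2 +
        2 * Real.cos (theta u v) * ((t l).fst * (t l).snd) + (t l).snd ^ 2) := by
      rw [Finset.sum_comm]
      refine Finset.sum_congr rfl fun l _ => ?_
      have : ∀ j, (p j * (t l).fst + q j * (t l).snd) ^ 2 = p j ^ 2 * (t l).fst ^ 2 +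
          p j * q j * (2 * ((t l).fst * (t l).snd)) + q j ^ 2 * (t l).snd ^ 2 := fun j => by ring
      simp_rw [this, Finset.sum_add_distrib, ← Finset.sum_mul]
      rw [hp1, hq1, hpq]
      ring
    have e2 : ∑ j, (p j ^ 2 + q j ^ 2) = 2 := by
      rw [Finset.sum_add_distrib, hp1, hq1]
      norm_num
    rw [e, e2] at h2
    refine h2.trans (le_of_eq ?_)
    ring

end

/-! ### Consequences of regularity: small coordinates and angles away from zero -/

noncomputable section

section regularPairs

variable {δ K κ : ℝ} {d : ℕ} {u v : EuclideanSpace ℝ (Fin d)}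

lemma le_one_add_rpow {a e : ℝ} (ha : 0 ≤ a) (he : 1 ≤ e) : a ≤ 1 + a ^ e := by
  rcases le_or_gt a 1 with h | h
  · linarith [Real.rpow_nonneg ha e]
  · linarith [Real.self_le_rpow_of_one_le h.le he]

lemma sum_sq_add_sq_le_of_mem_regularPairs (hδ : 0 < δ) (hd : 0 < d)
    (h : (u, v) ∈ regularPairs δ K κ d) : ∑ j, (u j ^ 2 + v j ^ 2) ≤ (1 + K) * d := by
  have hd0 : (0 : ℝ) < d := by exact_mod_cast hd
  have h1 : ∑ j, (u j ^ 2 + v j ^ 2) ^ ((2 + δ) / 2) ≤ K * d := (div_le_iff₀ hd0).1 h.1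
  have h2 : ∑ j, (u j ^ 2 + v j ^ 2) ≤ ∑ j, (1 + (u j ^ 2 + v j ^ 2) ^ ((2 + δ) / 2)) :=
    Finset.sum_le_sum fun j _ => le_one_add_rpow (by positivity) (by linarith)
  refine h2.trans ?_
  rw [Finset.sum_add_distrib]
  simp only [Finset.sum_const, Finset.card_univ, Fintype.card_fin, nsmul_eq_mul, mul_one]
  linarith

lemma norm_sq_div_le_of_mem_regularPairs (hδ : 0 < δ) (hd : 0 < d)
    (h : (u, v) ∈ regularPairs δ K κ d) : ‖u‖ ^ 2 / d ≤ 1 + K ∧ ‖v‖ ^ 2 / d ≤ 1 + K := by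
  have hd0 : (0 : ℝ) < d := by exact_mod_cast hd
  have h1 := sum_sq_add_sq_le_of_mem_regularPairs hδ hd h
  rw [Finset.sum_add_distrib, ← EuclideanSpace.real_norm_sq_eq,
    ← EuclideanSpace.real_norm_sq_eq] at h1
  rw [div_le_iff₀ hd0, div_le_iff₀ hd0]
  constructor <;> nlinarith [sq_nonneg ‖u‖, sq_nonneg ‖v‖]

lemma le_norm_sq_mul_of_mem_regularPairs (h : (u, v) ∈ regularPairs δ K κ d) :
    κ ≤ (‖u‖ ^ 2 / d) * (‖v‖ ^ 2 / d) := by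
  have h1 : κ ≤ (‖u‖ ^ 2 / d) * (‖v‖ ^ 2 / d) - (inner ℝ u v / d) ^ 2 := h.2
  linarith [sq_nonneg (inner ℝ u v / (d : ℝ))]

lemma norm_pos_of_mem_regularPairs (hκ : 0 < κ) (h : (u, v) ∈ regularPairs δ K κ d) :
    0 < ‖u‖ ∧ 0 < ‖v‖ := by
  have h1 := hκ.trans_le (le_norm_sq_mul_of_mem_regularPairs h)
  constructor <;> refine (norm_nonneg _).lt_of_ne fun h0 => ?_ <;> simp [← h0] at h1

/-- One term of the moment sum is at most the whole sum, which bounds `u j ^ 2 + v j ^ 2`. The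
averaged squared norms have product at least `κ` and are each at most `1 + K`, so each is at least
`κ / (1 + K)`. -/
lemma sq_div_add_sq_div_le_of_mem_regularPairs (hδ : 0 < δ) (hκ : 0 < κ) (hd : 0 < d)
    (h : (u, v) ∈ regularPairs δ K κ d) (j : Fin d) :
    u j ^ 2 / ‖u‖ ^ 2 + v j ^ 2 / ‖v‖ ^ 2 ≤
      (1 + K) ^ (2 / (2 + δ)) * ((1 + K) / κ) * ((d : ℝ) ^ (2 / (2 + δ)) / d) := by
  have hd0 : (0 : ℝ) < d := by exact_mod_cast hd
  obtain ⟨hu, hv⟩ := norm_pos_of_mem_regularPairs hκ h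
  obtain ⟨hu1, hv1⟩ := norm_sq_div_le_of_mem_regularPairs hδ hd h
  have h1 := le_norm_sq_mul_of_mem_regularPairs h
  have hB : 0 < 1 + K := lt_of_lt_of_le (by positivity) hu1
  set a := u j ^ 2 + v j ^ 2 with ha
  have ha0 : 0 ≤ a := by positivity
  have h2 : a ^ ((2 + δ) / 2) ≤ (1 + K) * d := by
    have h3 : ∑ j, (u j ^ 2 + v j ^ 2) ^ ((2 + δ) / 2) ≤ K * d := (div_le_iff₀ hd0).1 h.1
    have h4 : a ^ ((2 + δ) / 2) ≤ ∑ j, (u j ^ 2 + v j ^ 2) ^ ((2 + δ) / 2) :=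
      Finset.single_le_sum (f := fun j => (u j ^ 2 + v j ^ 2) ^ ((2 + δ) / 2))
        (fun i _ => Real.rpow_nonneg (by positivity) _) (Finset.mem_univ j)
    linarith
  have h3 : a ≤ (1 + K) ^ (2 / (2 + δ)) * (d : ℝ) ^ (2 / (2 + δ)) := by
    rw [← Real.mul_rpow hB.le hd0.le]
    have h4 := Real.rpow_le_rpow (Real.rpow_nonneg ha0 _) h2
      (show 0 ≤ 2 / (2 + δ) by positivity)
    rwa [← Real.rpow_mul ha0, show (2 + δ) / 2 * (2 / (2 + δ)) = 1 by field_simp,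
      Real.rpow_one] at h4
  have hu2 : κ / (1 + K) * d ≤ ‖u‖ ^ 2 := by
    rw [div_mul_eq_mul_div, div_le_iff₀ hB, ← le_div_iff₀ hd0, mul_div_right_comm]
    exact h1.trans (mul_le_mul_of_nonneg_left hv1 (by positivity))
  have hv2 : κ / (1 + K) * d ≤ ‖v‖ ^ 2 := by
    rw [div_mul_eq_mul_div, div_le_iff₀ hB, ← le_div_iff₀ hd0, mul_div_right_comm]
    rw [mul_comm] at h1
    exact h1.trans (mul_le_mul_of_nonneg_left hu1 (by positivity))
  calc u j ^ 2 / ‖u‖ ^ 2 + v j ^ 2 / ‖v‖ ^ 2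
      ≤ u j ^ 2 / (κ / (1 + K) * d) + v j ^ 2 / (κ / (1 + K) * d) := by gcongr
    _ = a / (κ / (1 + K) * d) := by rw [ha, add_div]
    _ ≤ ((1 + K) ^ (2 / (2 + δ)) * (d : ℝ) ^ (2 / (2 + δ))) / (κ / (1 + K) * d) := by gcongr
    _ = _ := by field_simp

/-- `1 - cos²` is the Gram determinant over the product of squared norms. Only an upper bound on the
cosine matters: angles near `π` just make collisions rarer. -/
lemma cosSim_le_of_mem_regularPairs (hδ : 0 < δ) (hκ : 0 < κ) (hd : 0 < d)
    (h : (u, v) ∈ regularPairs δ K κ d) : cosSim u v ≤ √(1 - κ / (1 + K) ^ 2) := by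
  have hd0 : (0 : ℝ) < d := by exact_mod_cast hd
  obtain ⟨hu, hv⟩ := norm_pos_of_mem_regularPairs hκ h
  obtain ⟨hu1, hv1⟩ := norm_sq_div_le_of_mem_regularPairs hδ hd h
  have hB : 0 < 1 + K := lt_of_lt_of_le (by positivity) hu1
  have h1 : κ ≤ (‖u‖ ^ 2 / d) * (‖v‖ ^ 2 / d) - (inner ℝ u v / d) ^ 2 := h.2
  refine Real.le_sqrt_of_sq_le ?_
  set A := (‖u‖ ^ 2 / d) * (‖v‖ ^ 2 / d) with hA
  have hA0 : 0 < A := by positivity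
  have hAB : A ≤ (1 + K) ^ 2 := by
    rw [hA, sq (1 + K)]
    exact mul_le_mul hu1 hv1 (by positivity) hB.le
  have e : cosSim u v ^ 2 = (inner ℝ u v / d) ^ 2 / A := by
    rw [cosSim, hA]
    field_simp
  calc cosSim u v ^ 2 ≤ (A - κ) / A := by
        rw [e]
        gcongr
        linarith
    _ = 1 - κ / A := by field_simp
    _ ≤ 1 - κ / (1 + K) ^ 2 := by gcongr

end regularPairs

lemma one_sub_arccos_div_pi_mem_Icc (x : ℝ) : 1 - Real.arccos x / Real.pi ∈ Set.Icc 0 1 := by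
  have h := Real.pi_pos
  have h1 : Real.arccos x / Real.pi ≤ 1 := (div_le_one h).2 (Real.arccos_le_pi x)
  have h2 : 0 ≤ Real.arccos x / Real.pi := div_nonneg (Real.arccos_nonneg x) h.le
  exact ⟨by linarith, by linarith⟩

/-- Since `2/(2+δ) - 1 = -δ/(2+δ)`, the growth of `m` uses up half of the decay and the other half
remains. -/
lemma tendsto_mul_rpow_div {δ : ℝ} (hδ : 0 < δ) {m : ℕ → ℕ}
    (hmo : (fun d => (m d : ℝ)) =o[atTop] fun d => (d : ℝ) ^ (δ / (2 * (2 + δ)))) :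
    Tendsto (fun d : ℕ => (m d : ℝ) * ((d : ℝ) ^ (2 / (2 + δ)) / d)) atTop (𝓝 0) := by
  have h1 : Tendsto (fun d : ℕ => (d : ℝ) ^ (-(δ / (2 * (2 + δ))))) atTop (𝓝 0) :=
    (tendsto_rpow_neg_atTop (by positivity)).comp tendsto_natCast_atTop_atTop
  refine squeeze_zero' (Eventually.of_forall fun d => by positivity) ?_ h1
  filter_upwards [hmo.bound one_pos, eventually_gt_atTop 0] with d hd hd0
  have hd1 : (0 : ℝ) < d := by exact_mod_cast hd0
  rw [Real.norm_of_nonneg (by positivity), Real.norm_of_nonneg (by positivity), one_mul] at hd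
  calc (m d : ℝ) * ((d : ℝ) ^ (2 / (2 + δ)) / d)
      ≤ (d : ℝ) ^ (δ / (2 * (2 + δ))) * ((d : ℝ) ^ (2 / (2 + δ)) / d) := by gcongr
    _ = (d : ℝ) ^ (δ / (2 * (2 + δ)) + (2 / (2 + δ) - 1)) := by
      rw [Real.rpow_add hd1, Real.rpow_sub_one hd1.ne']
    _ = (d : ℝ) ^ (-(δ / (2 * (2 + δ)))) := by
      congr 1
      field_simp
      ring

/-! ### Uniform collision estimates over regular pairs -/

section collision

variable {δ K κ : ℝ} {m : ℕ → ℕ} {Ω : ℕ → Type*} [∀ d, MeasurableSpace (Ω d)]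
  {μ : ∀ d, Measure (Ω d)} [∀ d, IsProbabilityMeasure (μ d)]
  {h : ∀ d, Fin d → Ω d → Fin (m d)} {s : ∀ d, Fin d → Ω d → ℤˣ}

lemma eventually_abs_collision_sub_le (hδ : 0 < δ) (hκ : 0 < κ) (hm : ∀ d, 1 ≤ m d)
    (hmo : (fun d => (m d : ℝ)) =o[atTop] fun d => (d : ℝ) ^ (δ / (2 * (2 + δ))))
    (hhs : ∀ d, IsCountSketchHash (μ d) (h d) (s d)) (k : ℕ) {ε : ℝ} (hε : 0 < ε) :
    ∀ᶠ d in atTop, ∀ u v, (u, v) ∈ regularPairs δ K κ d →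
      ∀ i : Fin k → Fin (m d), Function.Injective i →
      |(μ d).real {ω | ∀ l, csSRP (fun j => h d j ω) (fun j => s d j ω) u (i l) =
          csSRP (fun j => h d j ω) (fun j => s d j ω) v (i l)} -
        (1 - theta u v / Real.pi) ^ k| ≤ ε := by
  obtain ⟨τ, hτ, key⟩ := exists_pos_abs_collision_sub_le k hε
  have h1 := (tendsto_mul_rpow_div hδ hmo).const_mul
    ((1 + K) ^ (2 / (2 + δ)) * ((1 + K) / κ))
  rw [mul_zero] at h1
  filter_upwards [h1.eventually_le_const hτ, eventually_gt_atTop 0] with d hd hd0 u v huv i hi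
  obtain ⟨hu, hv⟩ := norm_pos_of_mem_regularPairs hκ huv
  refine key (μ d) (hhs d) (hm d) u v (norm_pos_iff.1 hu) (norm_pos_iff.1 hv) (fun j => ?_) i hi
  refine le_trans ?_ hd
  rw [mul_left_comm]
  exact mul_le_mul_of_nonneg_left
    (sq_div_add_sq_div_le_of_mem_regularPairs hδ hκ hd0 huv j) (by positivity)

lemma eventually_abs_bit_collision_sub_le (hδ : 0 < δ) (hκ : 0 < κ) (hm : ∀ d, 1 ≤ m d)
    (hmo : (fun d => (m d : ℝ)) =o[atTop] fun d => (d : ℝ) ^ (δ / (2 * (2 + δ))))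
    (hhs : ∀ d, IsCountSketchHash (μ d) (h d) (s d)) {ε : ℝ} (hε : 0 < ε) :
    ∀ᶠ d in atTop, ∀ u v, (u, v) ∈ regularPairs δ K κ d → ∀ l : Fin (m d),
      |(μ d).real {ω | csSRP (fun j => h d j ω) (fun j => s d j ω) u l =
          csSRP (fun j => h d j ω) (fun j => s d j ω) v l} -
        (1 - theta u v / Real.pi)| ≤ ε := by
  filter_upwards [eventually_abs_collision_sub_le hδ hκ hm hmo hhs 1 hε] with d hd u v huv l
  simpa using hd u v huv (fun _ => l) (Function.injective_of_subsingleton _)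

lemma eventually_abs_code_collision_sub_le (hδ : 0 < δ) (hκ : 0 < κ) (hm : ∀ d, 1 ≤ m d)
    (hmo : (fun d => (m d : ℝ)) =o[atTop] fun d => (d : ℝ) ^ (δ / (2 * (2 + δ))))
    (hhs : ∀ d, IsCountSketchHash (μ d) (h d) (s d)) {ε : ℝ} (hε : 0 < ε) :
    ∀ᶠ d in atTop, ∀ u v, (u, v) ∈ regularPairs δ K κ d →
      |(μ d).real {ω | ∀ l, csSRP (fun j => h d j ω) (fun j => s d j ω) u l =
          csSRP (fun j => h d j ω) (fun j => s d j ω) v l} -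
        (1 - theta u v / Real.pi) ^ m d| ≤ ε := by
  set c := 1 - Real.arccos √(1 - κ / (1 + K) ^ 2) / Real.pi with hc
  have hc01 := one_sub_arccos_div_pi_mem_Icc √(1 - κ / (1 + K) ^ 2)
  have hpc : ∀ d > 0, ∀ u v : EuclideanSpace ℝ (Fin d), (u, v) ∈ regularPairs δ K κ d →
      1 - theta u v / Real.pi ≤ c ∧ c < 1 := by
    intro d hd u v huv
    have hB : 0 < 1 + K := by
      have := norm_pos_of_mem_regularPairs hκ huv
      have hd0 : (0 : ℝ) < d := by exact_mod_cast hd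
      exact lt_of_lt_of_le (div_pos (pow_pos this.1 2) hd0)
        (norm_sq_div_le_of_mem_regularPairs hδ hd huv).1
    have hρ : √(1 - κ / (1 + K) ^ 2) < 1 := by
      rw [Real.sqrt_lt' one_pos, one_pow]
      have : 0 < κ / (1 + K) ^ 2 := by positivity
      linarith
    constructor
    · have := Real.antitone_arccos (cosSim_le_of_mem_regularPairs hδ hκ hd huv)
      have := div_le_div_of_nonneg_right this Real.pi_pos.le
      rw [hc, theta]
      linarith
    · have := div_pos (Real.arccos_pos.2 hρ) Real.pi_pos
      linarith
  -- `c < 1` is known only when some regular pair exists, so the choice of `k` is conditional; the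
  -- value `0` in the other case is never used.
  have hk : ∃ k : ℕ, c < 1 → c ^ k < ε / 2 := by
    by_cases h1 : c < 1
    · obtain ⟨k, hk⟩ := exists_pow_lt_of_lt_one (half_pos hε) h1
      exact ⟨k, fun _ => hk⟩
    · exact ⟨0, fun h => absurd h h1⟩
  obtain ⟨k, hk⟩ := hk
  -- The threshold in `d` depends on the number of bins, so all lengths below `k` are handled
  -- together as a finite intersection.
  have hsmall : ∀ᶠ d in atTop, ∀ k' ∈ Finset.range k, ∀ u v, (u, v) ∈ regularPairs δ K κ d →
      ∀ i : Fin k' → Fin (m d), Function.Injective i →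
      |(μ d).real {ω | ∀ l, csSRP (fun j => h d j ω) (fun j => s d j ω) u (i l) =
          csSRP (fun j => h d j ω) (fun j => s d j ω) v (i l)} -
        (1 - theta u v / Real.pi) ^ k'| ≤ ε :=
    (Filter.eventually_all_finset _).2 fun k' _ =>
      eventually_abs_collision_sub_le hδ hκ hm hmo hhs k' hε
  filter_upwards [hsmall, eventually_abs_collision_sub_le hδ hκ hm hmo hhs k (half_pos hε),
    eventually_gt_atTop 0] with d hd1 hd2 hd0 u v huv
  rcases lt_or_ge (m d) k with hmk | hmk
  · exact hd1 (m d) (Finset.mem_range.2 hmk) u v huv id Function.injective_id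
  · obtain ⟨hpc1, hc1⟩ := hpc d hd0 u v huv
    have hp := one_sub_arccos_div_pi_mem_Icc (cosSim u v)
    change 1 - theta u v / Real.pi ∈ _ at hp
    have h1 := hd2 u v huv (Fin.castLE hmk) (Fin.castLE_injective hmk)
    have h2 : (1 - theta u v / Real.pi) ^ k < ε / 2 :=
      (pow_le_pow_left₀ hp.1 hpc1 k).trans_lt (hk hc1)
    have h3 : (1 - theta u v / Real.pi) ^ m d ≤ (1 - theta u v / Real.pi) ^ k :=
      pow_le_pow_of_le_one hp.1 hp.2 hmk
    -- Agreement of the whole code forces agreement on the first `k` bins, whose probability is at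
    -- most `ε/2 + ε/2`.
    have h4 : (μ d).real {ω | ∀ l, csSRP (fun j => h d j ω) (fun j => s d j ω) u l =
          csSRP (fun j => h d j ω) (fun j => s d j ω) v l} ≤
        (μ d).real {ω | ∀ l, csSRP (fun j => h d j ω) (fun j => s d j ω) u (Fin.castLE hmk l) =
          csSRP (fun j => h d j ω) (fun j => s d j ω) v (Fin.castLE hmk l)} :=
      measureReal_mono fun ω hω l => hω (Fin.castLE hmk l)
    have h5 : 0 ≤ (μ d).real {ω | ∀ l, csSRP (fun j => h d j ω) (fun j => s d j ω) u l =
          csSRP (fun j => h d j ω) (fun j => s d j ω) v l} := measureReal_nonneg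
    have h6 : 0 ≤ (1 - theta u v / Real.pi) ^ m d := pow_nonneg hp.1 _
    have h7 := (abs_le.1 h1).2
    rw [abs_le]
    constructor <;> linarith

end collision

end

/-! ### Convergence and locality sensitivity -/

theorem mainTheorem3
    (δ K κ : ℝ) (hδ : 0 < δ) (hκ : 0 < κ)
    (m : ℕ → ℕ) (hm : ∀ d, 1 ≤ m d)
    (hmo : (fun d => (m d : ℝ)) =o[atTop] fun d => (d : ℝ) ^ (δ / (2 * (2 + δ))))
    {Ω : ℕ → Type*} [∀ d, MeasurableSpace (Ω d)]
    (μ : ∀ d, Measure (Ω d)) [∀ d, IsProbabilityMeasure (μ d)]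
    (h : ∀ d, Fin d → Ω d → Fin (m d)) (s : ∀ d, Fin d → Ω d → ℤˣ)
    (hhs : ∀ d, IsCountSketchHash (μ d) (h d) (s d)) :
    -- the hash code of `u` as a function of the randomness
    let ξ : ∀ d, Ω d → EuclideanSpace ℝ (Fin d) → Fin (m d) → Fin 2 :=
      fun d ω u => csSRP (fun j => h d j ω) (fun j => s d j ω) u
    (∀ u v : ∀ d, EuclideanSpace ℝ (Fin d),
      (∀ᶠ d in atTop, (u d, v d) ∈ regularPairs δ K κ d) →
      -- each bit, uniformly in the index of the bit
      (∀ ε > 0, ∀ᶠ d in atTop, ∀ l : Fin (m d),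
        |(μ d).real {ω | ξ d ω (u d) l = ξ d ω (v d) l}
          - (1 - theta (u d) (v d) / Real.pi)| ≤ ε) ∧
      -- all `m` bits
      Tendsto (fun d => (μ d).real {ω | ∀ l, ξ d ω (u d) l = ξ d ω (v d) l}
          - (1 - theta (u d) (v d) / Real.pi) ^ m d) atTop (𝓝 0)) ∧
    -- locality sensitivity for cosine similarity, of each bit and of the whole hash code
    (∀ R₁ R₂ : ℝ, -1 ≤ R₂ → R₂ < R₁ → R₁ ≤ 1 →
      (∀ l : ∀ d, Fin (m d),
        IsAsymptoticallySensitive μ (fun d ω u => ξ d ω u (l d)) (fun _ => cosSim)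
          (regularPairs δ K κ) R₁ R₂
          (fun _ => 1 - Real.arccos R₁ / Real.pi)
          (fun _ => 1 - Real.arccos R₂ / Real.pi)) ∧
      IsAsymptoticallySensitive μ ξ (fun _ => cosSim)
        (regularPairs δ K κ) R₁ R₂
        (fun d => (1 - Real.arccos R₁ / Real.pi) ^ m d)
        (fun d => (1 - Real.arccos R₂ / Real.pi) ^ m d)) := by
  intro ξ
  have hbit : ∀ ε > 0, ∀ᶠ d in atTop, ∀ u v, (u, v) ∈ regularPairs δ K κ d → ∀ l : Fin (m d),
      |(μ d).real {ω | ξ d ω u l = ξ d ω v l} - (1 - theta u v / Real.pi)| ≤ ε :=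
    fun ε hε => eventually_abs_bit_collision_sub_le hδ hκ hm hmo hhs hε
  have hcode : ∀ ε > 0, ∀ᶠ d in atTop, ∀ u v, (u, v) ∈ regularPairs δ K κ d →
      |(μ d).real {ω | ∀ l, ξ d ω u l = ξ d ω v l} - (1 - theta u v / Real.pi) ^ m d| ≤ ε :=
    fun ε hε => eventually_abs_code_collision_sub_le hδ hκ hm hmo hhs hε
  have hmono : ∀ x y : ℝ, x ≤ y →
      1 - Real.arccos x / Real.pi ≤ 1 - Real.arccos y / Real.pi := fun x y hxy =>
    sub_le_sub_left (div_le_div_of_nonneg_right (Real.antitone_arccos hxy) Real.pi_pos.le) 1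
  refine ⟨fun u v huv => ⟨fun ε hε => ?_, ?_⟩, fun R₁ R₂ h2 h21 h1 => ?_⟩
  · filter_upwards [hbit ε hε, huv] with d hd hd' l using hd _ _ hd' l
  · refine Metric.tendsto_nhds.2 fun ε hε => ?_
    filter_upwards [hcode (ε / 2) (half_pos hε), huv] with d hd hd'
    rw [Real.dist_eq, sub_zero]
    exact (hd _ _ hd').trans_lt (half_lt_self hε)
  · have hlt : 1 - Real.arccos R₂ / Real.pi < 1 - Real.arccos R₁ / Real.pi :=
      sub_lt_sub_left (div_lt_div_of_pos_right (Real.strictAntiOn_arccos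
        ⟨h2, h21.le.trans h1⟩ ⟨h2.trans h21.le, h1⟩ h21) Real.pi_pos) 1
    refine ⟨fun l => ⟨h21, fun _ => hlt, fun ε hε => ?_⟩, h21, fun d => ?_, fun ε hε => ?_⟩
    · filter_upwards [hbit ε hε] with d hd u v huv
      have hd' := abs_le.1 (hd u v huv (l d))
      refine ⟨fun hR => ?_, fun hR => ?_⟩
      · have : 1 - Real.arccos R₁ / Real.pi ≤ 1 - theta u v / Real.pi := hmono _ _ hR
        linarith
      · have : 1 - theta u v / Real.pi ≤ 1 - Real.arccos R₂ / Real.pi := hmono _ _ hR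
        linarith
    · exact pow_lt_pow_left₀ hlt (one_sub_arccos_div_pi_mem_Icc R₂).1
        (Nat.one_le_iff_ne_zero.1 (hm d))
    · filter_upwards [hcode ε hε] with d hd u v huv
      have hd' := abs_le.1 (hd u v huv)
      -- Bitwise agreement becomes equality of codes, the collision event of the sensitivity
      -- definition.
      simp only [← funext_iff] at hd'
      refine ⟨fun hR => ?_, fun hR => ?_⟩
      · have : (1 - Real.arccos R₁ / Real.pi) ^ m d ≤ (1 - theta u v / Real.pi) ^ m d :=
          pow_le_pow_left₀ (one_sub_arccos_div_pi_mem_Icc R₁).1 (hmono _ _ hR) _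
        linarith
      · have : (1 - theta u v / Real.pi) ^ m d ≤ (1 - Real.arccos R₂ / Real.pi) ^ m d :=
          pow_le_pow_left₀ (one_sub_arccos_div_pi_mem_Icc (cosSim u v)).1 (hmono _ _ hR) _
        linarith
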